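/- Let $n\ge 1$ and let $B(0,r)$ be the open ball of radius $r$ in $\mathbb R^n$. For an open set $\Omega\subset\mathbb R^n$ and a continuous $K:\mathbb R^n\to\mathbb R$, a *state-constraint viscosity solution* of $v+K(Dv)=0$ in $\Omega$ is a bounded uniformly continuous function $v$ on $\overline\Omega$ such that - (subsolution in $\Omega$) $v(x)+K(D\varphi(x))\le 0$ whenever $x\in\Omega$, $\varphi\in C^1(\Omega)$ and $v-\varphi$ has a local maximum over $\Omega$ at $x$; - (supersolution on $\overline\Omega$) $v(x)+K(D\varphi(x))\ge 0$ whenever $x\in\overline\Omega$, $\varphi\in C^1(\overline\Omega)$ (the restriction of a $C^1$ function on $\mathbb R^n$) and $v-\varphi$ has a local minimum over $\overline\Omega$ at $x$. Call $K:\mathbb R^n\to\mathbb R$ *admissible* if the Hamiltonian $H(x,p)=K(p)$ is continuous and satisfies: (H1) $H$ is bounded from below; (H2) $\sup_x|H(x,0)|<\infty$; (H3c) for each $R>0$ there is $C_R$ with $|H(x,p)-H(y,p)|\le C_R|x-y|$ and $|H(x,p)-H(x,q)|\le C_R|p-q|$ for all $x,y$ and all $|p|,|q|\le R$; (H4) $\inf_x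 H(x,p)\to+\infty$ as $|p|\to\infty$. It is not assumed that $K(0)=0$. **(Estimate)** For every admissible $K$ there is a constant $C>0$, depending only on $K$ (and $n$), with the following property. Let $k\ge1$ be an integer, let $u_k$ be a state-constraint viscosity solution of $u_k+K(Du_k)=0$ in $B(0,k)$, and let $u$ be a bounded uniformly continuous viscosity solution of $u+K(Du)=0$ in $\mathbb R^n$ (the case $\Omega=\mathbb R^n$ above). Then $$0\le u_k(x)-u(x)\le \left(Ce^{|x|/C}\right)e^{-k/C}\qquad\text{for all }x\in\overline{B(0,k)},$$ and, in particular, for every $R>0$ with $R\le k$, $$0\le u_k(x)-u(x)\le \left(Ce^{R/C}\right)e^{-k/C}\qquad\text{for all }x\in\overline{B(0,R)}.$$ **(Optimality)** This exponential rate is optimal: for every $C>0$ there is an admissible $K$ for which such solutions $u$ and $u_k$ $(k\ge 1)$ exist and all such solutions satisfy $$u_k(x)-u(x)=\left(Ce^{|x|/C}\right)e^{-k/C}\qquad\text{for all }k\ge1,\ x\in\overline{B(0,k)}.$$ -/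

import Mathlib

open Set Metric

/-- `v` is bounded and uniformly continuous on the set `S`. -/
def BUCOn {n : ℕ} (v : EuclideanSpace ℝ (Fin n) → ℝ)
    (S : Set (EuclideanSpace ℝ (Fin n))) : Prop :=
  UniformContinuousOn v S ∧ ∃ M : ℝ, ∀ x ∈ S, |v x| ≤ M

/-- `v` is a viscosity subsolution of `v + H(x, Dv) = 0` in the open set `Ω`. -/
def IsViscositySubsolution {n : ℕ}
    (H : EuclideanSpace ℝ (Fin n) → EuclideanSpace ℝ (Fin n) → ℝ)
    (Ω : Set (EuclideanSpace ℝ (Fin n))) (v : EuclideanSpace ℝ (Fin n) → ℝ) : Prop :=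
  BUCOn v Ω ∧
    ∀ x ∈ Ω, ∀ φ : EuclideanSpace ℝ (Fin n) → ℝ, ContDiffOn ℝ 1 φ Ω →
      IsLocalMaxOn (fun y => v y - φ y) Ω x → v x + H x (gradient φ x) ≤ 0

/-- `v` is a viscosity supersolution of `v + H(x, Dv) = 0` on the closure of `Ω`, up to and
including the boundary. The test functions of class `C¹` on the closure are the restrictions of
`C¹` functions on the whole space; the minimum is taken relative to the closure. -/
def IsViscositySupersolution {n : ℕ}
    (H : EuclideanSpace ℝ (Fin n) → EuclideanSpace ℝ (Fin n) → ℝ)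
    (Ω : Set (EuclideanSpace ℝ (Fin n))) (v : EuclideanSpace ℝ (Fin n) → ℝ) : Prop :=
  BUCOn v (closure Ω) ∧
    ∀ x ∈ closure Ω, ∀ φ : EuclideanSpace ℝ (Fin n) → ℝ, ContDiff ℝ 1 φ →
      IsLocalMinOn (fun y => v y - φ y) (closure Ω) x → 0 ≤ v x + H x (gradient φ x)

/-- `v` is a state-constraint viscosity solution of `v + H(x, Dv) = 0` in `Ω`: a subsolution in
`Ω` and a supersolution on the closure of `Ω`. Only the values of `v` on the closure matter. -/
def IsStateConstraintSolution {n : ℕ}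
    (H : EuclideanSpace ℝ (Fin n) → EuclideanSpace ℝ (Fin n) → ℝ)
    (Ω : Set (EuclideanSpace ℝ (Fin n))) (v : EuclideanSpace ℝ (Fin n) → ℝ) : Prop :=
  IsViscositySubsolution H Ω v ∧ IsViscositySupersolution H Ω v

/-- The assumptions on a Hamiltonian `H = H(x, p)` on `ℝⁿ × ℝⁿ`. -/
structure HamiltonianAssumptions {n : ℕ}
    (H : EuclideanSpace ℝ (Fin n) → EuclideanSpace ℝ (Fin n) → ℝ) : Prop where
  continuous : Continuous (fun z : EuclideanSpace ℝ (Fin n) × EuclideanSpace ℝ (Fin n) =>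
    H z.1 z.2)
  /-- (H1): `H` is bounded from below. -/
  bounded_below : ∃ C₁ : ℝ, 0 < C₁ ∧ ∀ x p, -H x p ≤ C₁
  /-- (H2): `H(x, 0)` is bounded. -/
  bounded_at_zero : ∃ C₂ : ℝ, 0 < C₂ ∧ ∀ x, |H x 0| ≤ C₂
  /-- (H3c): `H` is Lipschitz in `x` and in `p`, for `p` in bounded sets. -/
  locally_lipschitz : ∀ R : ℝ, 0 < R → ∃ C : ℝ, ∀ x y p q,
    ‖p‖ ≤ R → ‖q‖ ≤ R →
      |H x p - H y p| ≤ C * ‖x - y‖ ∧ |H x p - H x q| ≤ C * ‖p - q‖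
  /-- (H4): `inf_x H(x, p)` tends to `+∞` as `|p| → ∞`. -/
  coercive : ∀ M : ℝ, ∃ ρ : ℝ, ∀ p, ρ ≤ ‖p‖ → ∀ x, M ≤ H x p

open Filter Topology

section Prelims

variable {n : ℕ}

local notation "𝔼" => EuclideanSpace ℝ (Fin n)

/-! Every comparison here is against a `C¹` function, so no doubling of variables is needed. On the
whole space, a slowly growing penalty gives a touching point with small gradient, which forces `u =
-K 0` (`eq_const`). In the ball, the constant `-K 0` is a smooth subsolution and bounds `uk` from
below (`ge_of_contDiff`). For the upper bound (`le_exp`), choose `C` with `K 0 - K p ≤ C` and `K 0 -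
K p ≤ C * ‖p‖`: the radial exponential minus `K 0`, with the norm smoothed, is then a supersolution
inside and dominates every subsolution on the sphere.

For optimality, `wellHamiltonian` makes both bounds on `K` sharp. The radial exponential is the
maximum over unit vectors `a` of exponentials of `inner ℝ a x`, which are classical solutions; these
give the matching lower bound. -/

/-! ### Smoothed norm and exponential profile -/

/-- The smooth approximation `√(δ² + ‖x‖²)` of the norm. -/
noncomputable def smoothNorm (δ : ℝ) (x : 𝔼) : ℝ := Real.sqrt (δ ^ 2 + ‖x‖ ^ 2)

lemma smoothNorm_arg_pos {δ : ℝ} (hδ : 0 < δ) (x : 𝔼) : 0 < δ ^ 2 + ‖x‖ ^ 2 := by positivity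

lemma smoothNorm_pos {δ : ℝ} (hδ : 0 < δ) (x : 𝔼) : 0 < smoothNorm δ x :=
  Real.sqrt_pos.2 (smoothNorm_arg_pos hδ x)

lemma norm_le_smoothNorm (δ : ℝ) (x : 𝔼) : ‖x‖ ≤ smoothNorm δ x :=
  Real.le_sqrt_of_sq_le (by nlinarith [sq_nonneg δ])

lemma smoothNorm_le {δ : ℝ} (hδ : 0 < δ) (x : 𝔼) : smoothNorm δ x ≤ δ + ‖x‖ :=
  Real.sqrt_le_iff.2 ⟨by positivity, by nlinarith [mul_nonneg hδ.le (norm_nonneg x)]⟩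

lemma contDiff_smoothNorm {δ : ℝ} (hδ : 0 < δ) : ContDiff ℝ 1 (smoothNorm δ : 𝔼 → ℝ) :=
  (contDiff_const.add (contDiff_norm_sq ℝ)).sqrt fun x => (smoothNorm_arg_pos hδ x).ne'

lemma hasGradientAt_smoothNorm {δ : ℝ} (hδ : 0 < δ) (x : 𝔼) :
    HasGradientAt (smoothNorm δ) ((smoothNorm δ x)⁻¹ • x) x := by
  rw [hasGradientAt_iff_hasFDerivAt]
  have h := ((hasStrictFDerivAt_norm_sq x).hasFDerivAt.const_add (δ ^ 2)).sqrt
    (smoothNorm_arg_pos hδ x).ne'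
  refine h.congr_fderiv ?_
  have := (smoothNorm_pos hδ x).ne'
  ext y
  simp only [smoothNorm] at this ⊢
  simp
  field_simp

lemma norm_smoothNorm_gradient_le {δ : ℝ} (hδ : 0 < δ) (x : 𝔼) :
    ‖(smoothNorm δ x)⁻¹ • x‖ ≤ 1 := by
  have h := smoothNorm_pos hδ x
  rw [norm_smul, Real.norm_of_nonneg (by positivity), inv_mul_le_iff₀ h, mul_one]
  exact norm_le_smoothNorm δ x

/-- Chain rule for gradients. -/
lemma HasGradientAt.scalar_comp {f : 𝔼 → ℝ} {g x : 𝔼} {h : ℝ → ℝ} {h' : ℝ}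
    (hf : HasGradientAt f g x) (hh : HasDerivAt h h' (f x)) :
    HasGradientAt (fun y => h (f y)) (h' • g) x := by
  rw [hasGradientAt_iff_hasFDerivAt] at hf ⊢
  refine (hh.comp_hasFDerivAt x hf).congr_fderiv ?_
  ext y
  simp

/-- The profile solves `f = C * f'` with `f k = C`. -/
lemma hasDerivAt_exp_profile {C : ℝ} (hC : 0 < C) (k r : ℝ) :
    HasDerivAt (fun t => C * Real.exp ((t - k) / C)) (Real.exp ((r - k) / C)) r := by
  have h := ((((hasDerivAt_id r).sub_const k).div_const C).exp).const_mul C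
  refine h.congr_deriv ?_
  simp only [id]
  field_simp

/-! ### Rigidity on the whole space -/

/-- Functions which are subsolutions of `v ≤ G(Dv)` on the whole space lie below `G 0`. -/
lemma le_of_global_subsolution {v : 𝔼 → ℝ} {G : 𝔼 → ℝ} (hv : Continuous v) {M : ℝ}
    (hM : ∀ x, |v x| ≤ M) (hG : Continuous G)
    (h : ∀ x, ∀ φ : 𝔼 → ℝ, ContDiff ℝ 1 φ → IsLocalMax (fun y => v y - φ y) x →
      v x ≤ G (gradient φ x)) (y : 𝔼) : v y ≤ G 0 := by
  refine le_of_forall_pos_le_add fun η hη => ?_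
  obtain ⟨r, hr, hGr⟩ := Metric.continuousAt_iff.1 hG.continuousAt (η / 2) (by positivity)
  set s := smoothNorm 1 y with hs
  have hs0 : 0 < s := smoothNorm_pos one_pos y
  -- `ε < r` keeps the penalty's gradient where `G` is close to `G 0`; `ε * s ≤ η / 2` makes the
  -- penalty at `y` affordable.
  obtain ⟨ε, hε, hεr, hεs⟩ : ∃ ε : ℝ, 0 < ε ∧ ε < r ∧ ε * s ≤ η / 2 := by
    refine ⟨min (r / 2) (η / 2 / s), by positivity, (min_le_left _ _).trans_lt (by linarith), ?_⟩
    calc _ ≤ η / 2 / s * s := by gcongr; exact min_le_right _ _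
      _ = _ := by field_simp
  have hcont : Continuous fun z => -(v z - ε * smoothNorm 1 z) := by
    have := (contDiff_smoothNorm (n := n) one_pos).continuous
    fun_prop
  obtain ⟨x, hx⟩ := hcont.exists_forall_le (by
    refine tendsto_atTop_mono (f := fun z : 𝔼 => ε * ‖z‖ - M) (fun z => ?_) ?_
    · have := mul_le_mul_of_nonneg_left (norm_le_smoothNorm 1 z) hε.le
      have := (abs_le.1 (hM z)).2
      linarith
    · exact tendsto_atTop_add_const_right _ _
        ((tendsto_norm_cocompact_atTop).const_mul_atTop hε))
  have hgrad := (hasGradientAt_smoothNorm one_pos x).scalar_comp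
    ((hasDerivAt_id (smoothNorm 1 x)).const_mul ε)
  have h1 := h x (fun z => ε * smoothNorm 1 z) (contDiff_const.mul (contDiff_smoothNorm one_pos))
    (Filter.Eventually.of_forall fun z => by have := hx z; linarith)
  rw [show gradient (fun z => ε * smoothNorm 1 z) x = _ from hgrad.gradient] at h1
  have h2 := hGr (x := (ε * 1) • (smoothNorm 1 x)⁻¹ • x) (by
    rw [dist_zero_right, norm_smul, Real.norm_of_nonneg (by positivity)]
    nlinarith [norm_smoothNorm_gradient_le one_pos x])
  rw [Real.dist_eq, abs_lt] at h2
  have h3 := hx y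
  have h4 := mul_pos hε (smoothNorm_pos one_pos x)
  linarith

lemma gradient_neg_apply (φ : 𝔼 → ℝ) (x : 𝔼) :
    gradient (fun y => -φ y) x = -gradient φ x := by
  simp only [gradient, fderiv_fun_neg, map_neg]

/-- The only bounded uniformly continuous solution of `u + K(Du) = 0` on the whole space is the
constant `-K 0`. -/
theorem IsStateConstraintSolution.eq_const {K : 𝔼 → ℝ} (hK : Continuous K) {u : 𝔼 → ℝ}
    (hu : IsStateConstraintSolution (fun _ p => K p) Set.univ u) (x : 𝔼) : u x = -K 0 := by
  obtain ⟨⟨⟨huc, M, hM⟩, hsub⟩, _, hsup⟩ := hu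
  have hc : Continuous u := (uniformContinuousOn_univ.1 huc).continuous
  simp only [closure_univ, isLocalMaxOn_univ_iff, isLocalMinOn_univ_iff, mem_univ,
    forall_const] at hsub hsup hM
  apply le_antisymm
  · refine le_of_global_subsolution (G := fun p => -K p) hc hM hK.neg ?_ x
    intro z φ hφ hz
    have := hsub z φ hφ.contDiffOn hz
    linarith
  · have := le_of_global_subsolution (v := fun z => -u z) (G := fun p => K (-p)) hc.neg (M := M)
      (fun z => by rw [abs_neg]; exact hM z) (by fun_prop) (fun z φ hφ hz => by
        have := hsup z (fun y => -φ y) hφ.neg (by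
          filter_upwards [hz] with y hy
          linarith)
        rw [gradient_neg_apply] at this
        linarith) x
    simp only [neg_zero] at this
    linarith

/-! ### Bounds in a ball for general `K` -/

lemma closure_ball_nat {k : ℕ} (hk : 1 ≤ k) :
    closure (ball (0 : 𝔼) (k : ℝ)) = closedBall 0 (k : ℝ) :=
  closure_ball _ (by positivity)

/-- A supersolution up to the boundary of a ball is bounded below by any `C¹` function `φ`
with `φ ≤ -K(Dφ)` on the closed ball. -/
lemma IsViscositySupersolution.ge_of_contDiff {K : 𝔼 → ℝ} {k : ℕ} (hk : 1 ≤ k) {v : 𝔼 → ℝ}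
    (hv : IsViscositySupersolution (fun _ p => K p) (ball 0 (k : ℝ)) v) {φ : 𝔼 → ℝ}
    (hφ : ContDiff ℝ 1 φ)
    (h : ∀ x ∈ closedBall (0 : 𝔼) (k : ℝ), φ x + K (gradient φ x) ≤ 0) :
    ∀ x ∈ closedBall (0 : 𝔼) (k : ℝ), φ x ≤ v x := by
  obtain ⟨⟨huc, _⟩, hsup⟩ := hv
  rw [closure_ball_nat hk] at huc hsup
  obtain ⟨z, hz, hmin⟩ := (isCompact_closedBall (0 : 𝔼) (k : ℝ)).exists_isMinOn
    ⟨0, by simp⟩ (huc.continuousOn.sub hφ.continuous.continuousOn)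
  intro x hx
  have h1 := hsup z hz φ hφ hmin.localize
  have h2 := h z hz
  have h3 : v z - φ z ≤ v x - φ x := hmin hx
  linarith

/-- Touching a subsolution by steep paraboloids shows that it is bounded by `sup (-K)`. -/
lemma IsViscositySubsolution.le_of_bound {K : 𝔼 → ℝ} {M : ℝ} (hK : ∀ p, -K p ≤ M)
    {Ω : Set 𝔼} (hΩ : IsOpen Ω) {v : 𝔼 → ℝ}
    (hv : IsViscositySubsolution (fun _ p => K p) Ω v) : ∀ x ∈ Ω, v x ≤ M := by
  obtain ⟨⟨huc, B, hB⟩, hsub⟩ := hv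
  intro x hx
  obtain ⟨r, hr, hrΩ⟩ := Metric.nhds_basis_closedBall.mem_iff.1 (hΩ.mem_nhds hx)
  have hB0 : 0 ≤ B := (abs_nonneg _).trans (hB x hx)
  -- On the sphere of radius `r` the paraboloid equals `2 * B + 1`, more than the oscillation of
  -- `v`, so the maximum is interior.
  set N := (2 * B + 1) / r ^ 2 with hN
  have hN0 : 0 < N := by positivity
  have hφ : ContDiff ℝ 1 fun y : 𝔼 => N * ‖y - x‖ ^ 2 :=
    contDiff_const.mul ((contDiff_id.sub contDiff_const).norm_sq ℝ)
  obtain ⟨z, hz, hmax⟩ := (isCompact_closedBall x r).exists_isMaxOn ⟨x, by simp [hr.le]⟩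
    ((huc.continuousOn.mono hrΩ).sub hφ.continuous.continuousOn)
  have h1 : v x - N * ‖x - x‖ ^ 2 ≤ v z - N * ‖z - x‖ ^ 2 := hmax (by simp [hr.le])
  simp only [sub_self, norm_zero] at h1
  have hzr : z ∈ ball x r := by
    rw [mem_ball_iff_norm]
    refine (mem_closedBall_iff_norm.1 hz).lt_of_ne fun hzr => ?_
    rw [hzr, hN, div_mul_cancel₀ _ (by positivity)] at h1
    have := (abs_le.1 (hB x hx)).1
    have := (abs_le.1 (hB z (hrΩ hz))).2
    linarith
  have h2 := hsub z (hrΩ hz) _ hφ.contDiffOn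
    ((hmax.isLocalMax (mem_of_superset (isOpen_ball.mem_nhds hzr) ball_subset_closedBall)).on Ω)
  have h3 := hK (gradient (fun y : 𝔼 => N * ‖y - x‖ ^ 2) z)
  have h4 : 0 ≤ N * ‖z - x‖ ^ 2 := by positivity
  linarith

/-- The exponential upper bound for subsolutions in a ball. -/
theorem IsStateConstraintSolution.le_exp {K : 𝔼 → ℝ} {C : ℝ} (hC : 0 < C)
    (hK : ∀ p, K 0 - K p ≤ C) (hK' : ∀ p, K 0 - K p ≤ C * ‖p‖) {k : ℕ} (hk : 1 ≤ k) {v : 𝔼 → ℝ}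
    (hv : IsStateConstraintSolution (fun _ p => K p) (ball 0 (k : ℝ)) v)
    {x : 𝔼} (hx : x ∈ closedBall (0 : 𝔼) (k : ℝ)) :
    v x + K 0 ≤ C * Real.exp ((‖x‖ - k) / C) := by
  have hcont : ContinuousOn v (closedBall 0 (k : ℝ)) := by
    rw [← closure_ball_nat hk]
    exact hv.2.1.1.continuousOn
  have hle : ∀ y ∈ closedBall (0 : 𝔼) (k : ℝ), v y ≤ C - K 0 := by
    rw [← closure_ball_nat hk] at hcont ⊢
    exact fun y hy => le_on_closure
      (hv.1.le_of_bound (M := C - K 0) (fun p => by linarith [hK p]) isOpen_ball)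
      hcont continuousOn_const hy
  have key : ∀ δ : ℝ, 0 < δ → v x + K 0 ≤ C * Real.exp ((smoothNorm δ x - k) / C) := by
    intro δ hδ
    set φ : 𝔼 → ℝ := fun y => C * Real.exp ((smoothNorm δ y - k) / C) with hφdef
    have hφ : ContDiff ℝ 1 φ := contDiff_const.mul
      (((contDiff_smoothNorm hδ).sub contDiff_const).div_const C).exp
    obtain ⟨z, hz, hmax⟩ := (isCompact_closedBall (0 : 𝔼) (k : ℝ)).exists_isMaxOn
      ⟨0, by simp⟩ (hcont.sub hφ.continuous.continuousOn)
    have h1 : v x - φ x ≤ v z - φ z := hmax hx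
    suffices hzz : v z + K 0 ≤ φ z by
      change _ ≤ φ x
      linarith
    -- Inside, the equation gives `v z + K 0 ≤ C * ‖Dφ‖ ≤ φ z`. On the sphere there is no equation,
    -- but `φ ≥ C` since the smoothed norm is at least `k`.
    rcases (mem_closedBall_zero_iff.1 hz).lt_or_eq with hlt | heq
    · have hgrad := (hasGradientAt_smoothNorm hδ z).scalar_comp
        (hasDerivAt_exp_profile hC k (smoothNorm δ z))
      have h2 := hv.1.2 z (mem_ball_zero_iff.2 hlt) φ hφ.contDiffOn
        (hmax.on_subset ball_subset_closedBall).localize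
      rw [show gradient φ z = _ from hgrad.gradient] at h2
      have h3 := hK' (Real.exp ((smoothNorm δ z - k) / C) • (smoothNorm δ z)⁻¹ • z)
      rw [norm_smul, Real.norm_of_nonneg (Real.exp_pos _).le] at h3
      have h4 : Real.exp ((smoothNorm δ z - k) / C) * ‖(smoothNorm δ z)⁻¹ • z‖ ≤
          Real.exp ((smoothNorm δ z - k) / C) * 1 := by
        gcongr
        exact norm_smoothNorm_gradient_le hδ z
      have h5 := mul_le_mul_of_nonneg_left h4 hC.le
      simp only [hφdef]
      linarith
    · have h2 := hle z hz
      have h3 : 1 ≤ Real.exp ((smoothNorm δ z - k) / C) :=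
        Real.one_le_exp (div_nonneg (by linarith [norm_le_smoothNorm δ z]) hC.le)
      have h4 := mul_le_mul_of_nonneg_left h3 hC.le
      simp only [hφdef]
      linarith
  have hlim : Tendsto (fun δ : ℝ => C * Real.exp ((δ + ‖x‖ - k) / C)) (𝓝[>] 0)
      (𝓝 (C * Real.exp ((0 + ‖x‖ - k) / C))) :=
    (Continuous.tendsto (by fun_prop) 0).mono_left nhdsWithin_le_nhds
  rw [zero_add] at hlim
  refine ge_of_tendsto hlim ?_
  filter_upwards [self_mem_nhdsWithin] with δ hδ
  refine (key δ hδ).trans ?_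
  gcongr
  exact smoothNorm_le hδ x

/-- Near `p = 0` the Lipschitz bound is linear in `‖p‖`; for `‖p‖ ≥ 1` the lower bound on `K`
suffices. -/
lemma HamiltonianAssumptions.exists_bound {K : 𝔼 → ℝ}
    (hK : HamiltonianAssumptions (fun _ p => K p)) :
    ∃ C : ℝ, 0 < C ∧ (∀ p, K 0 - K p ≤ C) ∧ ∀ p, K 0 - K p ≤ C * ‖p‖ := by
  obtain ⟨C₁, hC₁, h₁⟩ := hK.bounded_below
  obtain ⟨L, hL⟩ := hK.locally_lipschitz 1 one_pos
  have hb : ∀ p, K 0 - K p ≤ |K 0| + C₁ + |L| := fun p => by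
    linarith [h₁ 0 p, le_abs_self (K 0), abs_nonneg L]
  refine ⟨|K 0| + C₁ + |L|, by positivity, hb, fun p => ?_⟩
  rcases le_total ‖p‖ 1 with hp | hp
  · have h := (hL 0 0 0 p (by simp) hp).2
    rw [zero_sub, norm_neg] at h
    calc K 0 - K p ≤ L * ‖p‖ := (le_abs_self _).trans h
      _ ≤ (|K 0| + C₁ + |L|) * ‖p‖ := by
        gcongr
        linarith [le_abs_self L, abs_nonneg (K 0)]
  · exact (hb p).trans (le_mul_of_one_le_right (by positivity) hp)

lemma exp_profile_mul (C r k : ℝ) :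
    C * Real.exp ((r - k) / C) = C * Real.exp (r / C) * Real.exp (-k / C) := by
  rw [mul_assoc, ← Real.exp_add]
  ring_nf

/-! ### The extremal Hamiltonian -/

/-- The Hamiltonian `C(||p| - 1| - 1)`. -/
noncomputable def wellHamiltonian (C : ℝ) (p : 𝔼) : ℝ := C * (|‖p‖ - 1| - 1)

lemma wellHamiltonian_zero (C : ℝ) : wellHamiltonian C (0 : 𝔼) = 0 := by
  simp [wellHamiltonian]

lemma continuous_wellHamiltonian (C : ℝ) : Continuous (wellHamiltonian C : 𝔼 → ℝ) := by
  unfold wellHamiltonian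
  fun_prop

lemma neg_le_wellHamiltonian {C : ℝ} (hC : 0 < C) (p : 𝔼) : -C ≤ wellHamiltonian C p := by
  unfold wellHamiltonian
  nlinarith [abs_nonneg (‖p‖ - 1)]

lemma neg_mul_norm_le_wellHamiltonian {C : ℝ} (hC : 0 < C) (p : 𝔼) :
    -(C * ‖p‖) ≤ wellHamiltonian C p := by
  unfold wellHamiltonian
  nlinarith [neg_le_abs (‖p‖ - 1)]

lemma wellHamiltonian_of_norm_le_one (C : ℝ) {p : 𝔼} (hp : ‖p‖ ≤ 1) :
    wellHamiltonian C p = -(C * ‖p‖) := by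
  rw [wellHamiltonian, abs_of_nonpos (by linarith)]
  ring

lemma hamiltonianAssumptions_wellHamiltonian {C : ℝ} (hC : 0 < C) :
    HamiltonianAssumptions (fun _ p : 𝔼 => wellHamiltonian C p) where
  continuous := (continuous_wellHamiltonian C).comp continuous_snd
  bounded_below := ⟨C, hC, fun _ p => by linarith [neg_le_wellHamiltonian hC p]⟩
  bounded_at_zero := ⟨1, one_pos, fun _ => by simp [wellHamiltonian_zero]⟩
  locally_lipschitz R _ := by
    refine ⟨C, fun x y p q _ _ => ⟨by simp; positivity, ?_⟩⟩
    rw [wellHamiltonian, wellHamiltonian, ← mul_sub, abs_mul, abs_of_pos hC]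
    gcongr
    calc _ = |(|‖p‖ - 1| - |‖q‖ - 1|)| := by ring_nf
      _ ≤ |(‖p‖ - 1) - (‖q‖ - 1)| := abs_abs_sub_abs_le_abs_sub _ _
      _ = |‖p‖ - ‖q‖| := by ring_nf
      _ ≤ ‖p - q‖ := abs_norm_sub_norm_le p q
  coercive M := by
    refine ⟨M / C + 2, fun p hp _ => ?_⟩
    rw [wellHamiltonian, ← div_le_iff₀' hC]
    linarith [le_abs_self (‖p‖ - 1)]

lemma isStateConstraintSolution_zero {K : 𝔼 → ℝ} (hK : K 0 = 0) :
    IsStateConstraintSolution (fun _ p => K p) Set.univ (fun _ => 0) := by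
  have hbuc : BUCOn (fun _ : 𝔼 => (0 : ℝ)) Set.univ :=
    ⟨uniformContinuousOn_univ.2 uniformContinuous_const, 0, by simp⟩
  have hgrad : ∀ (x : 𝔼) (φ : 𝔼 → ℝ), IsLocalExtr (fun y => 0 - φ y) x →
      K (gradient φ x) = 0 := by
    intro x φ h
    -- Smoothness of `φ` plays no role: `fderiv` is zero by default where `φ` is not differentiable.
    have h1 := h.fderiv_eq_zero
    simp only [zero_sub, fderiv_fun_neg, neg_eq_zero] at h1
    rw [gradient, h1, map_zero, hK]
  refine ⟨⟨hbuc, fun x _ φ _ h => ?_⟩, by rwa [closure_univ], fun x _ φ _ h => ?_⟩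
  · rw [isLocalMaxOn_univ_iff] at h
    simp [hgrad x φ (Or.inr h)]
  · rw [closure_univ, isLocalMinOn_univ_iff] at h
    simp [hgrad x φ (Or.inl h)]

/-! ### Plane and radial exponentials -/

lemma hasGradientAt_exp_inner {C : ℝ} (hC : 0 < C) (k : ℝ) (a x : 𝔼) :
    HasGradientAt (fun y => C * Real.exp ((inner ℝ a y - k) / C))
      (Real.exp ((inner ℝ a x - k) / C) • a) x := by
  have h : HasGradientAt (fun y : 𝔼 => inner ℝ a y) a x := by
    rw [hasGradientAt_iff_hasFDerivAt]
    exact (InnerProductSpace.toDual ℝ 𝔼 a).hasFDerivAt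
  exact h.scalar_comp (hasDerivAt_exp_profile hC k _)

lemma contDiff_exp_inner (C k : ℝ) (a : 𝔼) :
    ContDiff ℝ 1 fun y : 𝔼 => C * Real.exp ((inner ℝ a y - k) / C) :=
  contDiff_const.mul (((contDiff_const.inner ℝ contDiff_id).sub contDiff_const).div_const C).exp

/-- Every vector is a nonnegative multiple of a unit vector. -/
lemma exists_unit_inner_eq_norm (hn : 1 ≤ n) (x : 𝔼) :
    ∃ a : 𝔼, ‖a‖ = 1 ∧ inner ℝ a x = ‖x‖ := by
  rcases eq_or_ne x 0 with rfl | hx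
  · exact ⟨EuclideanSpace.single ⟨0, hn⟩ 1, by simp, by simp⟩
  · have := norm_ne_zero_iff.2 hx
    refine ⟨‖x‖⁻¹ • x, by simp [norm_smul, this], ?_⟩
    rw [real_inner_smul_left, real_inner_self_eq_norm_sq]
    field_simp

lemma inner_le_norm_of_unit {a : 𝔼} (ha : ‖a‖ = 1) (y : 𝔼) : inner ℝ a y ≤ ‖y‖ := by
  simpa [ha] using real_inner_le_norm a y

/-- If `φ` touches a radial exponential from below then its gradient is at most the slope. -/
lemma norm_gradient_le_of_isLocalMin {C : ℝ} (hC : 0 < C) (k : ℝ) {φ : 𝔼 → ℝ} {x : 𝔼}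
    (hφ : DifferentiableAt ℝ φ x)
    (h : IsLocalMin (fun y => C * Real.exp ((‖y‖ - k) / C) - φ y) x) :
    ‖gradient φ x‖ ≤ Real.exp ((‖x‖ - k) / C) := by
  set g := gradient φ x with hg
  set line : ℝ → 𝔼 := fun t => x + t • g with hline
  have hl : HasDerivAt line g 0 := by
    exact (((hasDerivAt_id (0 : ℝ)).smul_const g).const_add x).congr_deriv (one_smul ℝ g)
  have hl0 : line 0 = x := by simp [hline]
  have hφl : HasDerivAt (fun t => φ (line t)) (‖g‖ ^ 2) 0 := by
    have h1 : HasFDerivAt φ (InnerProductSpace.toDual ℝ 𝔼 g) (line 0) := by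
      rw [hl0]
      exact hasGradientAt_iff_hasFDerivAt.1 hφ.hasGradientAt
    refine (h1.comp_hasDerivAt 0 hl).congr_deriv ?_
    simp
  have hψ : HasDerivAt (fun t : ℝ => C * Real.exp ((‖x‖ + t * ‖g‖ - k) / C))
      (Real.exp ((‖x‖ - k) / C) * ‖g‖) 0 := by
    have h1 : HasDerivAt (fun t : ℝ => ‖x‖ + t * ‖g‖) ‖g‖ 0 := by
      simpa using ((hasDerivAt_id (0 : ℝ)).mul_const ‖g‖).const_add ‖x‖
    have h2 := hasDerivAt_exp_profile hC k (‖x‖ + 0 * ‖g‖)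
    have h3 := h2.comp (0 : ℝ) h1
    simpa [Function.comp_def] using h3
  -- Replacing `‖x + t • g‖` by the larger `‖x‖ + t * ‖g‖` keeps the minimum at `t = 0`, but only
  -- for `t ≥ 0`; it avoids the corner of the norm at `x = 0`.
  have hmin : IsLocalMinOn
      (fun t : ℝ => C * Real.exp ((‖x‖ + t * ‖g‖ - k) / C) - φ (line t)) (Ici 0) 0 := by
    have h1 : ∀ᶠ t in 𝓝 (0 : ℝ), C * Real.exp ((‖x‖ - k) / C) - φ x ≤
        C * Real.exp ((‖line t‖ - k) / C) - φ (line t) := by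
      have h2 : Tendsto line (𝓝 0) (𝓝 x) := by simpa [hl0] using hl.continuousAt.tendsto
      exact h2.eventually h
    filter_upwards [nhdsWithin_le_nhds h1, self_mem_nhdsWithin] with t ht ht0
    have h3 : ‖line t‖ ≤ ‖x‖ + t * ‖g‖ := by
      refine (norm_add_le _ _).trans ?_
      rw [norm_smul, Real.norm_of_nonneg ht0]
    have h4 : C * Real.exp ((‖line t‖ - k) / C) ≤
        C * Real.exp ((‖x‖ + t * ‖g‖ - k) / C) := by gcongr
    simp only [zero_mul, add_zero, hl0]
    linarith
  have hder := hmin.hasFDerivWithinAt_nonneg (hψ.sub hφl).hasFDerivAt.hasFDerivWithinAt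
    (y := 1) (mem_posTangentConeAt_of_segment_subset (by
      rw [zero_add, segment_eq_Icc zero_le_one]
      exact fun t ht => ht.1))
  simp only [ContinuousLinearMap.toSpanSingleton_apply, one_smul] at hder
  rcases (norm_nonneg g).eq_or_lt with h0 | h0
  · rw [← h0]
    positivity
  · nlinarith

/-- The radial exponential is the state-constraint solution in the ball. -/
theorem isStateConstraintSolution_exp (hn : 1 ≤ n) {C : ℝ} (hC : 0 < C) {k : ℕ} (hk : 1 ≤ k) :
    IsStateConstraintSolution (fun _ p : 𝔼 => wellHamiltonian C p) (ball 0 (k : ℝ))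
      (fun x => C * Real.exp ((‖x‖ - k) / C)) := by
  have hbuc : BUCOn (fun x : 𝔼 => C * Real.exp ((‖x‖ - k) / C)) (closedBall 0 (k : ℝ)) := by
    have hcont : Continuous fun x : 𝔼 => C * Real.exp ((‖x‖ - k) / C) := by fun_prop
    refine ⟨(isCompact_closedBall _ _).uniformContinuousOn_of_continuous hcont.continuousOn, ?_⟩
    exact (isCompact_closedBall _ _).exists_bound_of_continuousOn hcont.continuousOn
  have hbuc' : BUCOn (fun x : 𝔼 => C * Real.exp ((‖x‖ - k) / C)) (ball 0 (k : ℝ)) :=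
    ⟨hbuc.1.mono ball_subset_closedBall,
      hbuc.2.imp fun _ hM x hx => hM x (ball_subset_closedBall hx)⟩
  refine ⟨⟨hbuc', fun x hx φ hφ hmax => ?_⟩, by rwa [closure_ball_nat hk],
    fun x hx φ hφ hmin => ?_⟩
  · obtain ⟨a, ha, hax⟩ := exists_unit_inner_eq_norm hn x
    have hmax' := hmax.isLocalMax (isOpen_ball.mem_nhds hx)
    have hφx := (hφ.contDiffAt (isOpen_ball.mem_nhds hx)).differentiableAt one_ne_zero
    -- The plane exponential lies below the radial one with equality at `x`, so `φ` touches it from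
    -- above too, which determines `gradient φ x`.
    have hloc : IsLocalMax (fun y => C * Real.exp ((inner ℝ a y - k) / C) - φ y) x := by
      filter_upwards [hmax'] with y hy
      rw [hax]
      refine le_trans ?_ hy
      gcongr
      exact inner_le_norm_of_unit ha y
    have hg := hasGradientAt_exp_inner hC k a x
    have heq := hloc.hasFDerivAt_eq_zero
      ((hasGradientAt_iff_hasFDerivAt.1 hg).sub
        (hasGradientAt_iff_hasFDerivAt.1 hφx.hasGradientAt))
    rw [sub_eq_zero] at heq
    have hgr := (InnerProductSpace.toDual ℝ 𝔼).injective heq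
    have hnorm : ‖gradient φ x‖ = Real.exp ((‖x‖ - k) / C) := by
      rw [← hgr, norm_smul, ha, mul_one, Real.norm_of_nonneg (Real.exp_pos _).le, hax]
    beta_reduce
    rw [wellHamiltonian_of_norm_le_one, hnorm]
    · linarith
    · rw [hnorm, Real.exp_le_one_iff]
      exact div_nonpos_of_nonpos_of_nonneg
        (by linarith [mem_ball_zero_iff.1 hx]) hC.le
  · rw [closure_ball_nat hk] at hx hmin
    rcases (mem_closedBall_zero_iff.1 hx).lt_or_eq with hlt | heq
    · have h1 := norm_gradient_le_of_isLocalMin hC k (hφ.differentiable one_ne_zero x)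
        (hmin.isLocalMin (mem_of_superset (isOpen_ball.mem_nhds (mem_ball_zero_iff.2 hlt))
          ball_subset_closedBall))
      have h2 := neg_mul_norm_le_wellHamiltonian hC (gradient φ x)
      have h3 := mul_le_mul_of_nonneg_left h1 hC.le
      linarith
    -- On the sphere the value is `C = -min K`, so any gradient is admissible.
    · have h2 := neg_le_wellHamiltonian hC (gradient φ x)
      simp only [heq, sub_self, zero_div, Real.exp_zero]
      linarith

/-- The state-constraint solution in the ball is unique. -/
theorem IsStateConstraintSolution.eq_exp (hn : 1 ≤ n) {C : ℝ} (hC : 0 < C) {k : ℕ} (hk : 1 ≤ k)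
    {v : 𝔼 → ℝ}
    (hv : IsStateConstraintSolution (fun _ p : 𝔼 => wellHamiltonian C p) (ball 0 (k : ℝ)) v)
    {x : 𝔼} (hx : x ∈ closedBall (0 : 𝔼) (k : ℝ)) :
    v x = C * Real.exp ((‖x‖ - k) / C) := by
  apply le_antisymm
  · have := hv.le_exp hC (fun p => by
      rw [wellHamiltonian_zero]; linarith [neg_le_wellHamiltonian hC p]) (fun p => by
      rw [wellHamiltonian_zero]; linarith [neg_mul_norm_le_wellHamiltonian hC p]) hk hx
    rwa [wellHamiltonian_zero, add_zero] at this
  · obtain ⟨a, ha, hax⟩ := exists_unit_inner_eq_norm hn x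
    -- In the closed ball the slope is at most `1`, the range where the Hamiltonian is `-C * ‖p‖`.
    have := hv.2.ge_of_contDiff hk (contDiff_exp_inner C k a) (fun z hz => by
      have hnorm : ‖Real.exp ((inner ℝ a z - k) / C) • a‖ = Real.exp ((inner ℝ a z - k) / C) := by
        rw [norm_smul, ha, mul_one, Real.norm_of_nonneg (Real.exp_pos _).le]
      rw [(hasGradientAt_exp_inner hC k a z).gradient, wellHamiltonian_of_norm_le_one, hnorm]
      · linarith
      · rw [hnorm, Real.exp_le_one_iff]
        exact div_nonpos_of_nonpos_of_nonneg
          (by linarith [mem_closedBall_zero_iff.1 hz, inner_le_norm_of_unit ha z]) hC.le) x hx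
    rwa [hax] at this

end Prelims

theorem corollary1p3 (n : ℕ) (hn : 1 ≤ n) :
    -- the exponential estimate, for every Hamiltonian `H(x, p) = K(p)`
    (∀ K : EuclideanSpace ℝ (Fin n) → ℝ, HamiltonianAssumptions (fun _ p => K p) →
      ∃ C : ℝ, 0 < C ∧
        ∀ u : EuclideanSpace ℝ (Fin n) → ℝ,
          IsStateConstraintSolution (fun _ p => K p) Set.univ u →
        ∀ k : ℕ, 1 ≤ k →
        ∀ uk : EuclideanSpace ℝ (Fin n) → ℝ,
          IsStateConstraintSolution (fun _ p => K p) (Metric.ball 0 (k : ℝ)) uk →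
          (∀ x ∈ Metric.closedBall (0 : EuclideanSpace ℝ (Fin n)) (k : ℝ),
            0 ≤ uk x - u x ∧
              uk x - u x ≤ (C * Real.exp (‖x‖ / C)) * Real.exp (-(k : ℝ) / C)) ∧
          (∀ R : ℝ, 0 < R → R ≤ (k : ℝ) →
            ∀ x ∈ Metric.closedBall (0 : EuclideanSpace ℝ (Fin n)) R,
              0 ≤ uk x - u x ∧
                uk x - u x ≤ (C * Real.exp (R / C)) * Real.exp (-(k : ℝ) / C))) ∧
    -- optimality: for every `C > 0` the estimate is an equality for some Hamiltonian `K(p)`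
    (∀ C : ℝ, 0 < C →
      ∃ K : EuclideanSpace ℝ (Fin n) → ℝ, HamiltonianAssumptions (fun _ p => K p) ∧
        (∃ u : EuclideanSpace ℝ (Fin n) → ℝ,
          IsStateConstraintSolution (fun _ p => K p) Set.univ u) ∧
        (∀ k : ℕ, 1 ≤ k → ∃ uk : EuclideanSpace ℝ (Fin n) → ℝ,
          IsStateConstraintSolution (fun _ p => K p) (Metric.ball 0 (k : ℝ)) uk) ∧
        ∀ u : EuclideanSpace ℝ (Fin n) → ℝ,
          IsStateConstraintSolution (fun _ p => K p) Set.univ u →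
        ∀ k : ℕ, 1 ≤ k →
        ∀ uk : EuclideanSpace ℝ (Fin n) → ℝ,
          IsStateConstraintSolution (fun _ p => K p) (Metric.ball 0 (k : ℝ)) uk →
        ∀ x ∈ Metric.closedBall (0 : EuclideanSpace ℝ (Fin n)) (k : ℝ),
          uk x - u x = (C * Real.exp (‖x‖ / C)) * Real.exp (-(k : ℝ) / C)) := by
  refine ⟨fun K hK => ?_, fun C hC => ?_⟩
  · obtain ⟨C, hC, hb, hb'⟩ := hK.exists_bound
    have hKc : Continuous K := hK.continuous.comp (Continuous.prodMk_right 0)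
    refine ⟨C, hC, fun u hu k hk uk huk => ?_⟩
    have main : ∀ x ∈ Metric.closedBall (0 : EuclideanSpace ℝ (Fin n)) (k : ℝ),
        0 ≤ uk x - u x ∧
          uk x - u x ≤ (C * Real.exp (‖x‖ / C)) * Real.exp (-(k : ℝ) / C) := by
      intro x hx
      have hux := hu.eq_const hKc x
      have hlow := huk.2.ge_of_contDiff hk (φ := fun _ => -K 0) contDiff_const
        (fun z _ => by simp [gradient]) x hx
      have hup := huk.le_exp hC hb hb' hk hx
      rw [exp_profile_mul] at hup
      exact ⟨by linarith, by linarith⟩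
    refine ⟨main, fun R _ hRk x hx => ?_⟩
    obtain ⟨h0, h1⟩ := main x (closedBall_subset_closedBall hRk hx)
    refine ⟨h0, h1.trans ?_⟩
    gcongr
    exact mem_closedBall_zero_iff.1 hx
  · have hK := hamiltonianAssumptions_wellHamiltonian (n := n) hC
    refine ⟨wellHamiltonian C, hK, ⟨_, isStateConstraintSolution_zero (wellHamiltonian_zero C)⟩,
      fun k hk => ⟨_, isStateConstraintSolution_exp hn hC hk⟩, fun u hu k hk uk huk x hx => ?_⟩
    rw [hu.eq_const (continuous_wellHamiltonian C) x, wellHamiltonian_zero, huk.eq_exp hn hC hk hx, neg_zero, sub_zero,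
      exp_profile_mul]
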